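/- A continuum is a nonempty connected compact Hausdorff space; a subcontinuum of a continuum is a nonempty closed connected subset. A continuum is hereditarily indecomposable if none of its subcontinua is the union of two proper subcontinua of itself. The weight of a space is the least cardinality of a base for its topology. A partition between two disjoint closed sets $A,B$ of $X$ is a set $X\setminus(U\cup V)$ with $U\supseteq A$ and $V\supseteq B$ disjoint open sets. For $I=[0,1]$, a continuous map $f:X\to I^\kappa$ is essential if, for every choice of partitions $L_\alpha$ between $f^{-1}[\{x:x_\alpha=0\}]$ and $f^{-1}[\{x:x_\alpha=1\}]$ ($\alpha<\kappa$), the intersection $\bigcap_{\alpha<\kappa}L_\alpha$ is nonempty. **Theorem.** For every infinite cardinal $\kappa$ there is a hereditarily indecomposable continuum $X$ of weight $\kappa$ that admits an essential map onto (i.e. a surjective essential map to) the Tychonoff cube $I^\kappa$. -/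

import Mathlib

universe u v

namespace HIContinua

/-- The weight of a topological space: the least cardinality of a base for its open sets. -/
noncomputable def weight (X : Type u) [TopologicalSpace X] : Cardinal.{u} :=
  sInf {c | ∃ B : Set (Set X), TopologicalSpace.IsTopologicalBasis B ∧ Cardinal.mk B = c}

/-- `X` is a continuum: a (nonempty) connected compact Hausdorff space. -/
structure IsContinuum (X : Type u) [TopologicalSpace X] : Prop where
  compact : CompactSpace X
  hausdorff : T2Space X
  connected : ConnectedSpace X

/-- `K` is a subcontinuum of the compact Hausdorff space `X`: closed, connected and nonempty
(`IsConnected` includes nonemptiness). -/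
def IsSubcontinuum {X : Type u} [TopologicalSpace X] (K : Set X) : Prop :=
  IsClosed K ∧ IsConnected K

/-- `K` is the union of two proper subcontinua. -/
def IsDecomposable {X : Type u} [TopologicalSpace X] (K : Set X) : Prop :=
  ∃ A B : Set X, IsSubcontinuum A ∧ IsSubcontinuum B ∧ A ⊂ K ∧ B ⊂ K ∧ A ∪ B = K

/-- Every subcontinuum of `X` is indecomposable. -/
def HereditarilyIndecomposable (X : Type u) [TopologicalSpace X] : Prop :=
  ∀ K : Set X, IsSubcontinuum K → ¬ IsDecomposable K

/-- `L` is a partition between `A` and `B`: the complement of the union of two disjoint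
open sets, one around `A` and the other around `B`. -/
def IsPartition {X : Type u} [TopologicalSpace X] (L A B : Set X) : Prop :=
  ∃ U V : Set X, IsOpen U ∧ IsOpen V ∧ Disjoint U V ∧ A ⊆ U ∧ B ⊆ V ∧ L = (U ∪ V)ᶜ

/-- A family of pairs of disjoint closed sets is essential if any choice of partitions, one
for each pair, has nonempty intersection. -/
def IsEssentialFamily {X : Type u} [TopologicalSpace X] {ι : Type v} (A B : ι → Set X) : Prop :=
  (∀ i, IsClosed (A i) ∧ IsClosed (B i) ∧ Disjoint (A i) (B i)) ∧
    ∀ L : ι → Set X, (∀ i, IsPartition (L i) (A i) (B i)) → (⋂ i, L i).Nonempty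

/-- The face `x_i = 0` of the Tychonoff cube. -/
def faceZero {ι : Type v} (i : ι) : Set (ι → unitInterval) := {x | x i = 0}

/-- The face `x_i = 1` of the Tychonoff cube. -/
def faceOne {ι : Type v} (i : ι) : Set (ι → unitInterval) := {x | x i = 1}

/-- A continuous map to the Tychonoff cube is essential if the preimages of the pairs of
opposite faces form an essential family. -/
def IsEssentialMap {X : Type u} [TopologicalSpace X] {ι : Type v}
    (f : X → ι → unitInterval) : Prop :=
  Continuous f ∧ IsEssentialFamily (fun i => f ⁻¹' faceZero i) (fun i => f ⁻¹' faceOne i)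

end HIContinua

/-! Work in the cube `I ^ (ι ⊕ ι)` with `#ι = κ`, all of whose pairs of opposite faces together form
an essential family. The second half of the coordinates is spent on indecomposability, the first
half keeps the essential map.

The cube has a base of at most κ sets, so the quadruples of basic sets can be indexed by the second
summand. For each one, `exists_separation_isCrookedOn` gives a partition between the corresponding
faces that is folded in three; by `disjoint_of_isCrookedOn` two continua inside it, each near only
one end, cannot meet. Every continuum in the intersection `Y` of these partitions is therefore
hereditarily indecomposable. The remaining pairs stay essential on `Y`, since otherwise all pairs of
faces could be separated by open sets covering the cube.

A minimal closed subset of `Y` on which these pairs are essential is connected. Projection of it to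
the first summand is essential, hence onto; the embedding in the cube bounds the weight above and
the surjection bounds it below. -/

namespace HIContinua

/-! ### Kuhn's cubical lemma by cup products and Stokes' formula modulo two -/

section CubicalLemma

variable {ι : Type v} [DecidableEq ι]

/-- Forward difference in direction `i`, modulo two. -/
def diff (i : ι) (g : (ι → ℕ) → ZMod 2) (x : ι → ℕ) : ZMod 2 :=
  g (x + Pi.single i 1) + g x

/-- The cup product of the coboundaries of the functions `lam k`, for `k` in the list, evaluated
on the cube at `x` that is spanned by the directions in `S`. -/
def cup (lam : ι → (ι → ℕ) → ZMod 2) : List ι → Finset ι → (ι → ℕ) → ZMod 2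
  | [], _, _ => 1
  | k :: l, S, x => ∑ i ∈ S, diff i (lam k) x * cup lam l (S.erase i) (x + Pi.single i 1)

lemma diff_mul (i : ι) (a b : (ι → ℕ) → ZMod 2) (x : ι → ℕ) :
    diff i (fun y => a y * b y) x = diff i a x * b (x + Pi.single i 1) + a x * diff i b x := by
  have h : (2 : ZMod 2) = 0 := rfl
  simp only [diff]
  linear_combination (-(a x * b (x + Pi.single i 1))) * h

lemma diff_sum {α : Type*} (s : Finset α) (i : ι) (g : α → (ι → ℕ) → ZMod 2) (x : ι → ℕ) :
    diff i (fun y => ∑ j ∈ s, g j y) x = ∑ j ∈ s, diff i (g j) x := by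
  simp [diff, Finset.sum_add_distrib]

lemma diff_comm (i j : ι) (g : (ι → ℕ) → ZMod 2) (x : ι → ℕ) :
    diff i (diff j g) x = diff j (diff i g) x := by
  simp only [diff, add_right_comm x (Pi.single i 1) (Pi.single j 1)]
  ring

/-- A symmetric sum over ordered pairs of distinct elements vanishes modulo two. -/
lemma sum_offDiag_symm_eq_zero (S : Finset ι) (F : ι → ι → ZMod 2) (hF : ∀ i j, F i j = F j i) :
    ∑ i ∈ S, ∑ j ∈ S.erase i, F i j = 0 := by
  induction S using Finset.induction_on with
  | empty => simp
  | insert a S ha ih =>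
    rw [Finset.sum_insert ha, Finset.erase_insert ha]
    have h : ∑ i ∈ S, ∑ j ∈ (insert a S).erase i, F i j
        = ∑ i ∈ S, (F i a + ∑ j ∈ S.erase i, F i j) := by
      refine Finset.sum_congr rfl fun i hi => ?_
      have hia : a ≠ i := fun h => ha (h ▸ hi)
      rw [Finset.erase_insert_of_ne hia, Finset.sum_insert (by simp [ha])]
    rw [h, Finset.sum_add_distrib, ih, add_zero, ← Finset.sum_add_distrib]
    exact Finset.sum_eq_zero fun i _ => by rw [hF i a]; exact CharTwo.add_self_eq_zero _

/-- The cup product of coboundaries is a cocycle. -/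
lemma sum_diff_cup (lam : ι → (ι → ℕ) → ZMod 2) (l : List ι) :
    ∀ (S : Finset ι) (x : ι → ℕ), ∑ i ∈ S, diff i (cup lam l (S.erase i)) x = 0 := by
  induction l with
  | nil =>
    intro S x
    exact Finset.sum_eq_zero fun i _ => by simp only [diff, cup]; rfl
  | cons k l ih =>
    intro S x
    -- The Leibniz rule leaves a second-difference sum, symmetric in `i` and `j` and so zero modulo
    -- two, and a sum covered by the induction hypothesis.
    have h1 : ∀ i ∈ S, diff i (cup lam (k :: l) (S.erase i)) x
        = ∑ j ∈ S.erase i, diff i (diff j (lam k)) x *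
            cup lam l ((S.erase i).erase j) (x + Pi.single i 1 + Pi.single j 1)
          + ∑ j ∈ S.erase i, diff j (lam k) x *
            diff i (cup lam l ((S.erase j).erase i)) (x + Pi.single j 1) := by
      intro i _
      have : cup lam (k :: l) (S.erase i) = fun y => ∑ j ∈ S.erase i, (fun y => diff j (lam k) y *
          (fun z => cup lam l ((S.erase i).erase j) (z + Pi.single j 1)) y) y := by
        funext y; rfl
      rw [this, diff_sum, ← Finset.sum_add_distrib]
      refine Finset.sum_congr rfl fun j _ => ?_
      refine (diff_mul i (diff j (lam k))
        (fun z => cup lam l ((S.erase i).erase j) (z + Pi.single j 1)) x).trans ?_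
      congr 2
      simp only [diff, add_right_comm x (Pi.single i 1) (Pi.single j 1),
        Finset.erase_right_comm (a := i) (b := j)]
    rw [Finset.sum_congr rfl h1, Finset.sum_add_distrib, sum_offDiag_symm_eq_zero, zero_add]
    · have h2 : ∀ (f : ι → ι → ZMod 2), ∑ i ∈ S, ∑ j ∈ S.erase i, f i j
          = ∑ j ∈ S, ∑ i ∈ S.erase j, f i j := by
        intro f
        refine Finset.sum_comm' fun a b => ?_
        simp only [Finset.mem_erase, ne_comm (a := a) (b := b)]
        tauto
      rw [h2]
      refine Finset.sum_eq_zero fun j _ => ?_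
      rw [← Finset.mul_sum, ih, mul_zero]
    · intro i j
      rw [diff_comm, Finset.erase_right_comm, add_right_comm]

/-- Since the remaining product is a cocycle, the whole product is a coboundary; its sum over a box
thus reduces to the boundary. -/
lemma cup_cons_eq_sum_diff (lam : ι → (ι → ℕ) → ZMod 2) (k : ι) (l : List ι) (S : Finset ι)
    (x : ι → ℕ) : cup lam (k :: l) S x
      = ∑ i ∈ S, diff i (fun y => lam k y * cup lam l (S.erase i) y) x := by
  simp only [diff_mul, Finset.sum_add_distrib, ← Finset.mul_sum, sum_diff_cup, mul_zero, add_zero]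
  rfl

/-- Sum along the segment `0 ≤ x i < N`. -/
def lineSum (N : ℕ) (i : ι) (g : (ι → ℕ) → ZMod 2) (x : ι → ℕ) : ZMod 2 :=
  ∑ c ∈ Finset.range N, g (Function.update x i c)

/-- Sum over the box `0 ≤ x i < N` for `i` in the list. -/
def boxSum (N : ℕ) : List ι → ((ι → ℕ) → ZMod 2) → (ι → ℕ) → ZMod 2
  | [], g => g
  | i :: l, g => boxSum N l (lineSum N i g)

lemma lineSum_comm (N : ℕ) (i j : ι) (g : (ι → ℕ) → ZMod 2) :
    lineSum N i (lineSum N j g) = lineSum N j (lineSum N i g) := by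
  funext x
  rcases eq_or_ne i j with rfl | h
  · rfl
  · simp only [lineSum]
    rw [Finset.sum_comm]
    simp only [Function.update_comm h]

/-- Allows summing first in whichever direction the summand telescopes. -/
lemma boxSum_perm (N : ℕ) {l l' : List ι} (h : l.Perm l') (g : (ι → ℕ) → ZMod 2) :
    boxSum N l g = boxSum N l' g := by
  induction h generalizing g with
  | nil => rfl
  | cons x _ ih => exact ih _
  | swap x y l => simp only [boxSum, lineSum_comm]
  | trans _ _ h1 h2 => rw [h1, h2]

lemma boxSum_sum (N : ℕ) {α : Type*} (s : Finset α) (l : List ι) :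
    ∀ (g : α → (ι → ℕ) → ZMod 2) (x : ι → ℕ),
      boxSum N l (fun y => ∑ a ∈ s, g a y) x = ∑ a ∈ s, boxSum N l (g a) x := by
  induction l with
  | nil => intro g x; rfl
  | cons i l ih =>
    intro g x
    simp only [boxSum]
    rw [← ih]
    congr 1
    funext y
    simp only [lineSum]
    rw [Finset.sum_comm]

lemma boxSum_update (N : ℕ) (k : ι) (c : ℕ) (l : List ι) :
    ∀ (g : (ι → ℕ) → ZMod 2) (x : ι → ℕ), k ∉ l →
      boxSum N l (fun y => g (Function.update y k c)) x
        = boxSum N l g (Function.update x k c) := by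
  induction l with
  | nil => intro g x _; rfl
  | cons i l ih =>
    intro g x hk
    rw [List.mem_cons, not_or] at hk
    simp only [boxSum]
    rw [← ih _ _ hk.2]
    congr 1
    funext y
    simp only [lineSum]
    simp only [Function.update_comm hk.1]

lemma lineSum_diff (N : ℕ) (i : ι) (g : (ι → ℕ) → ZMod 2) (x : ι → ℕ) :
    lineSum N i (diff i g) x = g (Function.update x i N) + g (Function.update x i 0) := by
  have h : ∀ c, Function.update x i c + Pi.single i 1 = Function.update x i (c + 1) := by
    intro c; funext j
    by_cases hj : j = i
    · subst hj; simp
    · simp [hj]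
  simp only [lineSum, diff, h]
  induction N with
  | zero => simp [CharTwo.add_self_eq_zero]
  | succ n ih =>
    rw [Finset.sum_range_succ, ih]
    have h2 : (2 : ZMod 2) = 0 := rfl
    linear_combination g (Function.update x i n) * h2

/-- The cup product vanishes on a face on which one of its factors is constant. -/
lemma cup_eq_zero_of_face (lam : ι → (ι → ℕ) → ZMod 2) (i : ι) (c : ℕ) (r : ZMod 2)
    (hc : ∀ x, x i = c → lam i x = r) (l : List ι) :
    ∀ (S : Finset ι) (x : ι → ℕ), i ∈ l → i ∉ S → x i = c → cup lam l S x = 0 := by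
  induction l with
  | nil => intro S x h; simp at h
  | cons k l ih =>
    intro S x hl hS hx
    refine Finset.sum_eq_zero fun j hj => ?_
    have hji : i ≠ j := fun h => hS (h ▸ hj)
    -- As `i ∉ S`, no step leaves the face.
    have hx' : (x + Pi.single j 1 : ι → ℕ) i = c := by simp [hx, hji]
    by_cases hk : i = k
    · subst hk
      rw [diff, hc _ hx', hc _ hx, CharTwo.add_self_eq_zero, zero_mul]
    · rw [ih (S.erase j) _ ((List.mem_cons.1 hl).resolve_left hk) (by simp [hS]) hx', mul_zero]

/-- The total value of the cup product over a box is odd. -/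
lemma boxSum_cup (N : ℕ) (lam : ι → (ι → ℕ) → ZMod 2) (h0 : ∀ i x, x i = 0 → lam i x = 0)
    (h1 : ∀ i x, x i = N → lam i x = 1) (l : List ι) :
    ∀ (x : ι → ℕ), l.Nodup → boxSum N l (cup lam l l.toFinset) x = 1 := by
  induction l with
  | nil => intro x _; rfl
  | cons k l ih =>
    intro x hl
    have hkl := (List.nodup_cons.1 hl).1
    have e : cup lam (k :: l) (k :: l).toFinset = fun y => ∑ i ∈ (k :: l).toFinset,
        diff i (fun z => lam k z * cup lam l ((k :: l).toFinset.erase i) z) y := by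
      funext y; exact cup_cons_eq_sum_diff _ _ _ _ _
    -- Stokes: faces in directions of `l` contribute nothing by `cup_eq_zero_of_face`. In direction
    -- `k` the factor `lam k` kills the face at 0 and is 1 on the face at `N`, leaving the box of
    -- one dimension less.
    rw [e, boxSum_sum, List.toFinset_cons, Finset.sum_insert (by simpa using hkl),
      Finset.erase_insert (by simpa using hkl), Finset.sum_eq_zero, add_zero]
    · simp only [boxSum]
      rw [← ih (Function.update x k N) (List.nodup_cons.1 hl).2, ← boxSum_update N k N l _ _ hkl]
      congr 1
      funext y
      rw [lineSum_diff, h1 k _ (by simp), h0 k _ (by simp), one_mul, zero_mul, add_zero]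
    · intro i hi
      have hi : i ∈ l := by simpa using hi
      have hp : (k :: l).Perm (i :: (k :: l).erase i) :=
        List.perm_cons_erase (List.mem_cons_of_mem _ hi)
      rw [boxSum_perm N hp]
      simp only [boxSum]
      have hz : lineSum N i (diff i fun z => lam k z *
          cup lam l ((insert k l.toFinset).erase i) z) = fun y => ∑ _a ∈ (∅ : Finset ι), 0 := by
        funext y
        rw [lineSum_diff, cup_eq_zero_of_face lam i N 1 (h1 i) l _ _ hi (by simp) (by simp),
          cup_eq_zero_of_face lam i 0 0 (h0 i) l _ _ hi (by simp) (by simp)]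
        simp
      rw [hz, boxSum_sum N ∅ _ (fun _ _ => 0)]
      simp

lemma exists_of_boxSum_ne_zero (N : ℕ) (l : List ι) :
    ∀ (g : (ι → ℕ) → ZMod 2) (x : ι → ℕ), boxSum N l g x ≠ 0 → ∃ y, g y ≠ 0 := by
  induction l with
  | nil => intro g x h; exact ⟨x, h⟩
  | cons i l ih =>
    intro g x h
    obtain ⟨y, hy⟩ := ih _ _ h
    obtain ⟨c, _, hc⟩ := Finset.exists_ne_zero_of_sum_ne_zero hy
    exact ⟨_, hc⟩

/-- A nonzero summand traces a monotone edge path in the cube, with one edge for each `k` in the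
list along which `lam k` changes. -/
lemma exists_ne_of_cup_ne_zero (lam : ι → (ι → ℕ) → ZMod 2) (l : List ι) :
    ∀ (S : Finset ι) (x : ι → ℕ), cup lam l S x ≠ 0 → ∀ k ∈ l, ∃ z w : ι → ℕ,
      (∀ i, x i ≤ z i ∧ z i ≤ x i + if i ∈ S then 1 else 0) ∧
      (∀ i, x i ≤ w i ∧ w i ≤ x i + if i ∈ S then 1 else 0) ∧ lam k z ≠ lam k w := by
  induction l with
  | nil => intro S x _ k hk; simp at hk
  | cons m l ih =>
    intro S x h k hk
    obtain ⟨i, hi, hne⟩ := Finset.exists_ne_zero_of_sum_ne_zero h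
    rcases List.mem_cons.1 hk with rfl | hk
    · refine ⟨x + Pi.single i 1, x, fun j => ?_, fun j => by simp, fun he => ?_⟩
      · by_cases hj : j = i
        · subst hj; simp [hi]
        · simp [hj]
      · apply left_ne_zero_of_mul hne
        rw [diff, he, CharTwo.add_self_eq_zero]
    · obtain ⟨z, w, hz, hw, hzw⟩ := ih _ _ (right_ne_zero_of_mul hne) k hk
      have key : ∀ z : ι → ℕ, (∀ j, (x + Pi.single i 1 : ι → ℕ) j ≤ z j ∧
          z j ≤ (x + Pi.single i 1 : ι → ℕ) j + if j ∈ S.erase i then 1 else 0) →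
          ∀ j, x j ≤ z j ∧ z j ≤ x j + if j ∈ S then 1 else 0 := by
        intro z hz j
        have := hz j
        by_cases hj : j = i
        · subst hj
          simp [hi] at this ⊢
          omega
        · simpa [hj] using this
      exact ⟨z, w, key z hz, key w hw, hzw⟩

/-- Kuhn's cubical lemma: if each `lam i` is `0` on the face `x i = 0` and `1` on the face
`x i = N`, then some unit cube of the grid carries both values of every `lam i`. -/
theorem exists_cube_forall_ne [Fintype ι] (N : ℕ) (lam : ι → (ι → ℕ) → ZMod 2)
    (h0 : ∀ i x, x i = 0 → lam i x = 0) (h1 : ∀ i x, x i = N → lam i x = 1) :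
    ∃ x : ι → ℕ, ∀ k, ∃ z w : ι → ℕ, (∀ i, x i ≤ z i ∧ z i ≤ x i + 1) ∧
      (∀ i, x i ≤ w i ∧ w i ≤ x i + 1) ∧ lam k z ≠ lam k w := by
  have hb := boxSum_cup N lam h0 h1 Finset.univ.toList 0 (Finset.nodup_toList _)
  obtain ⟨x, hx⟩ := exists_of_boxSum_ne_zero N _ _ _ (by rw [hb]; exact one_ne_zero)
  refine ⟨x, fun k => ?_⟩
  obtain ⟨z, w, hz, hw, h⟩ := exists_ne_of_cup_ne_zero lam _ _ _ hx k (by simp)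
  simp only [Finset.toList_toFinset, Finset.mem_univ, if_true] at hz hw
  exact ⟨z, w, hz, hw, h⟩

end CubicalLemma

/-! ### Essentiality of the faces of cubes -/

section Cube

/-- Open sets that separate the opposite faces of a finite-dimensional cube do not cover it. -/
theorem exists_notMem_of_separates_faces_of_fintype {ι : Type v} [Fintype ι]
    (U V : ι → Set (ι → unitInterval))
    (hU : ∀ i, IsOpen (U i)) (hV : ∀ i, IsOpen (V i)) (hd : ∀ i, Disjoint (U i) (V i))
    (h0 : ∀ i, faceZero i ⊆ U i) (h1 : ∀ i, faceOne i ⊆ V i) :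
    ∃ x, ∀ i, x ∉ U i ∧ x ∉ V i := by
  classical
  by_contra hcon
  push Not at hcon
  have hcov : (Set.univ : Set (ι → unitInterval)) ⊆ ⋃ s : ι ⊕ ι, Sum.elim U V s := by
    intro x _
    obtain ⟨i, hi⟩ := hcon x
    by_cases hx : x ∈ U i
    · exact Set.mem_iUnion.2 ⟨Sum.inl i, hx⟩
    · exact Set.mem_iUnion.2 ⟨Sum.inr i, hi hx⟩
  obtain ⟨δ, hδ, hball⟩ := lebesgue_number_lemma_of_metric isCompact_univ
    (c := fun s : ι ⊕ ι => Sum.elim U V s) (by rintro (i | i); exacts [hU i, hV i]) hcov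
  obtain ⟨n, hn⟩ := exists_nat_one_div_lt hδ
  set N : ℕ := n + 1 with hN
  have hNpos : (0 : ℝ) < N := by rw [hN]; positivity
  -- Clamping is needed because the unit cube supplied by Kuhn's lemma is not known to lie in the
  -- box `[0, N]`.
  let p : (ι → ℕ) → ι → unitInterval := fun y i => Set.projIcc 0 1 zero_le_one ((y i : ℝ) / N)
  let lam : ι → (ι → ℕ) → ZMod 2 := fun i y => if p y ∈ U i then 0 else 1
  obtain ⟨x, hx⟩ := exists_cube_forall_ne N lam
    (fun i y hy => if_pos (h0 i (by
      change Set.projIcc (0 : ℝ) 1 _ _ = _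
      rw [hy, Nat.cast_zero, zero_div]; exact Set.projIcc_left (zero_le_one (α := ℝ)))))
    (fun i y hy => if_neg (fun hyU => Set.disjoint_left.1 (hd i) hyU (h1 i (by
      change Set.projIcc (0 : ℝ) 1 _ _ = _
      rw [hy, div_self hNpos.ne']; exact Set.projIcc_right (zero_le_one (α := ℝ))))))
  have hclose : ∀ z : ι → ℕ, (∀ i, x i ≤ z i ∧ z i ≤ x i + 1) → p z ∈ Metric.ball (p x) δ := by
    intro z hz
    rw [Metric.mem_ball, dist_pi_lt_iff hδ]
    intro i
    have hlip := (LipschitzWith.projIcc (zero_le_one (α := ℝ))).dist_le_mul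
      ((z i : ℝ) / N) ((x i : ℝ) / N)
    refine lt_of_le_of_lt hlip (lt_of_le_of_lt ?_ hn)
    rw [Real.dist_eq, ← sub_div, abs_div, abs_of_pos hNpos, NNReal.coe_one, one_mul, hN,
      Nat.cast_add, Nat.cast_one]
    have a : (x i : ℝ) ≤ z i := by exact_mod_cast (hz i).1
    have b : (z i : ℝ) ≤ x i + 1 := by exact_mod_cast (hz i).2
    gcongr
    rw [abs_le]; constructor <;> linarith
  -- The whole small cube lies in one `U k` or one `V k`, so `lam k` is constant on it.
  obtain ⟨s, hs⟩ := hball (p x) trivial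
  rcases s with k | k
  · obtain ⟨z, w, hz, hw, hne⟩ := hx k
    apply hne
    change ite _ _ _ = ite _ _ _
    rw [if_pos (show p z ∈ U k from hs (hclose z hz)),
      if_pos (show p w ∈ U k from hs (hclose w hw))]
  · obtain ⟨z, w, hz, hw, hne⟩ := hx k
    apply hne
    change ite _ _ _ = ite _ _ _
    rw [if_neg fun h => Set.disjoint_left.1 (hd k) h (hs (hclose z hz)),
      if_neg fun h => Set.disjoint_left.1 (hd k) h (hs (hclose w hw))]

/-- Open sets that separate the opposite faces of a Tychonoff cube do not cover it. -/
theorem exists_notMem_of_separates_faces {ι : Type v} (U V : ι → Set (ι → unitInterval))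
    (hU : ∀ i, IsOpen (U i)) (hV : ∀ i, IsOpen (V i)) (hd : ∀ i, Disjoint (U i) (V i))
    (h0 : ∀ i, faceZero i ⊆ U i) (h1 : ∀ i, faceOne i ⊆ V i) :
    ∃ x, ∀ i, x ∉ U i ∧ x ∉ V i := by
  classical
  by_contra hcon
  push Not at hcon
  obtain ⟨F, hF⟩ := isCompact_univ.elim_finite_subcover (fun i => U i ∪ V i)
    (fun i => (hU i).union (hV i)) (fun x _ => by
      obtain ⟨i, hi⟩ := hcon x
      refine Set.mem_iUnion.2 ⟨i, ?_⟩
      by_cases hx : x ∈ U i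
      exacts [Or.inl hx, Or.inr (hi hx)])
  -- Compactness leaves finitely many coordinates; restrict to the subcube where the others are 0.
  let e : (F → unitInterval) → ι → unitInterval := fun y i => if h : i ∈ F then y ⟨i, h⟩ else 0
  have he : Continuous e := by
    refine continuous_pi fun i => ?_
    by_cases h : i ∈ F
    · simpa [e, h] using continuous_apply _
    · simpa [e, h] using continuous_const
  have hei : ∀ y (i : F), e y i = y i := fun y i => by simp [e]
  obtain ⟨y, hy⟩ := exists_notMem_of_separates_faces_of_fintype (ι := F)
    (fun i => e ⁻¹' U i) (fun i => e ⁻¹' V i) (fun i => (hU i).preimage he)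
    (fun i => (hV i).preimage he) (fun i => (hd i).preimage e)
    (fun i y hy => h0 i ((hei y i).trans hy)) (fun i y hy => h1 i ((hei y i).trans hy))
  obtain ⟨i, hi, hm⟩ := Set.mem_iUnion₂.1 (hF (Set.mem_univ (e y)))
  rcases hm with hm | hm
  exacts [(hy ⟨i, hi⟩).1 hm, (hy ⟨i, hi⟩).2 hm]

end Cube

/-! ### Essential families on closed subsets -/

section Essential

variable {Z : Type u} [TopologicalSpace Z] {ι : Type v}

/-- The set `S` is covered by disjoint pairs of open sets that separate the pairs `A i`, `B i`. -/
def IsInessentialOn (A B : ι → Set Z) (S : Set Z) : Prop :=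
  ∃ U V : ι → Set Z, (∀ i, IsOpen (U i)) ∧ (∀ i, IsOpen (V i)) ∧ (∀ i, Disjoint (U i) (V i)) ∧
    (∀ i, A i ⊆ U i) ∧ (∀ i, B i ⊆ V i) ∧ S ⊆ ⋃ i, (U i ∪ V i)

/-- Separations relative to a closed set `S` that cover `S` extend to the whole space. -/
lemma isInessentialOn_of_relative [CompactSpace Z] [T2Space Z] {A B : ι → Set Z}
    (hA : ∀ i, IsClosed (A i)) (hB : ∀ i, IsClosed (B i)) (hAB : ∀ i, Disjoint (A i) (B i))
    {S : Set Z} (hS : IsClosed S) {U V : ι → Set Z} (hU : ∀ i, IsOpen (U i))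
    (hV : ∀ i, IsOpen (V i)) (hd : ∀ i, Disjoint (U i ∩ S) (V i ∩ S)) (hAU : ∀ i, A i ∩ S ⊆ U i)
    (hBV : ∀ i, B i ∩ S ⊆ V i) (hcov : S ⊆ ⋃ i, (U i ∪ V i)) : IsInessentialOn A B S := by
  classical
  have hw : ∀ s, IsOpen (Sum.elim U V s) := by rintro (i | i); exacts [hU i, hV i]
  obtain ⟨t, ht⟩ := hS.isCompact.elim_finite_subcover (Sum.elim U V) hw (fun x hx => by
    obtain ⟨i, hi | hi⟩ := Set.mem_iUnion.1 (hcov hx)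
    exacts [Set.mem_iUnion.2 ⟨Sum.inl i, hi⟩, Set.mem_iUnion.2 ⟨Sum.inr i, hi⟩])
  -- Shrinking the cover to closed sets lets normality of `Z` separate them, together with `A i` and
  -- `B i`, while still covering `S`.
  obtain ⟨w, hSw, hwc, hwu⟩ := exists_subset_iUnion_closed_subset hS
    (u := fun s => if s ∈ t then Sum.elim U V s else ∅)
    (fun s => by by_cases h : s ∈ t <;> simp [h, hw])
    (fun x _ => t.finite_toSet.subset fun s hs => by
      by_contra h
      have h' : s ∉ t := h
      simp [h'] at hs)
    (fun x hx => by
      obtain ⟨s, hs, hxs⟩ := Set.mem_iUnion₂.1 (ht hx)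
      exact Set.mem_iUnion.2 ⟨s, by simpa [hs] using hxs⟩)
  have hwe : ∀ s, w s ⊆ Sum.elim U V s := fun s x hx => by
    have := hwu s hx
    by_cases h : s ∈ t
    · simpa [h] using this
    · simp [h] at this
  have hsep : ∀ i, SeparatedNhds (w (Sum.inl i) ∩ S ∪ A i) (w (Sum.inr i) ∩ S ∪ B i) := by
    intro i
    refine normal_separation (((hwc _).inter hS).union (hA i)) (((hwc _).inter hS).union (hB i)) ?_
    have hdi := Set.disjoint_left.1 (hd i)
    rw [Set.disjoint_left]
    rintro x (⟨h1, h2⟩ | h1) (⟨h3, h4⟩ | h3)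
    · exact hdi ⟨hwe _ h1, h2⟩ ⟨hwe _ h3, h2⟩
    · exact hdi ⟨hwe _ h1, h2⟩ ⟨hBV i ⟨h3, h2⟩, h2⟩
    · exact hdi ⟨hAU i ⟨h1, h4⟩, h4⟩ ⟨hwe _ h3, h4⟩
    · exact Set.disjoint_left.1 (hAB i) h1 h3
  choose U' V' hU' hV' hUs hVs hd' using hsep
  refine ⟨U', V', hU', hV', hd', fun i x hx => hUs i (Or.inr hx), fun i x hx => hVs i (Or.inr hx),
    fun x hx => ?_⟩
  obtain ⟨i | i, hi⟩ := Set.mem_iUnion.1 (hSw hx)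
  · exact Set.mem_iUnion.2 ⟨i, Or.inl (hUs i (Or.inl ⟨hi, hx⟩))⟩
  · exact Set.mem_iUnion.2 ⟨i, Or.inr (hVs i (Or.inl ⟨hi, hx⟩))⟩

/-- A closed set on which a family of pairs is essential contains a continuum with the same
property. -/
theorem exists_isConnected_not_isInessentialOn [CompactSpace Z] [T2Space Z] {A B : ι → Set Z}
    (hA : ∀ i, IsClosed (A i)) (hB : ∀ i, IsClosed (B i)) (hAB : ∀ i, Disjoint (A i) (B i))
    {Y : Set Z} (hY : IsClosed Y) (hess : ¬ IsInessentialOn A B Y) :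
    ∃ K ⊆ Y, IsClosed K ∧ IsConnected K ∧ ¬ IsInessentialOn A B K := by
  obtain ⟨K, hKY, hK⟩ := zorn_superset_nonempty {S : Set Z | IsClosed S ∧ ¬ IsInessentialOn A B S}
    (by
      intro c hc hch hne
      refine ⟨⋂₀ c, ⟨isClosed_sInter fun s hs => (hc hs).1, ?_⟩,
        fun s hs => Set.sInter_subset_of_mem hs⟩
      rintro ⟨U, V, hU, hV, hd, hAU, hBV, hcov⟩
      have : Nonempty c := hne.to_subtype
      obtain ⟨s, hs⟩ := exists_subset_nhds_of_isCompact (V := fun s : c => (s : Set Z))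
        (by
          intro a b
          rcases hch.total a.2 b.2 with h | h
          exacts [⟨a, subset_rfl, h⟩, ⟨b, h, subset_rfl⟩])
        (fun s => (hc s.2).1.isCompact) (U := ⋃ i, (U i ∪ V i))
        (fun x hx => (isOpen_iUnion fun i => (hU i).union (hV i)).mem_nhds
          (hcov (by rwa [Set.sInter_eq_iInter])))
      exact (hc s.2).2 ⟨U, V, hU, hV, hd, hAU, hBV, hs⟩) Y ⟨hY, hess⟩
  obtain ⟨⟨hKc, hKe⟩, hmin⟩ := hK
  have hlt : ∀ E : Set Z, IsClosed E → E ⊆ K → E ≠ K → IsInessentialOn A B E := by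
    intro E hE hEK hne
    by_contra h
    exact hne (hEK.antisymm (hmin ⟨hE, h⟩ hEK))
  refine ⟨K, hKY, hKc, ⟨?_, ?_⟩, hKe⟩
  · rw [Set.nonempty_iff_ne_empty]
    rintro rfl
    refine hKe (isInessentialOn_of_relative hA hB hAB hKc (U := fun _ => ∅) (V := fun _ => ∅)
      ?_ ?_ ?_ ?_ ?_ ?_) <;> simp
  · rw [isPreconnected_closed_iff]
    intro E F hE hF hcov ⟨a, haK, haE⟩ ⟨b, hbK, hbF⟩
    by_contra hemp
    rw [Set.not_nonempty_iff_eq_empty] at hemp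
    have hdis : ∀ x ∈ K, x ∈ E → x ∈ F → False := fun x h1 h2 h3 => by
      have : x ∈ K ∩ (E ∩ F) := ⟨h1, h2, h3⟩
      simp [hemp] at this
    obtain ⟨U₁, V₁, hU₁, hV₁, hd₁, hAU₁, hBV₁, hc₁⟩ := hlt (K ∩ E) (hKc.inter hE)
      Set.inter_subset_left (fun h => hdis b hbK (h.ge hbK).2 hbF)
    obtain ⟨U₂, V₂, hU₂, hV₂, hd₂, hAU₂, hBV₂, hc₂⟩ := hlt (K ∩ F) (hKc.inter hF)
      Set.inter_subset_left (fun h => hdis a haK haE (h.ge haK).2)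
    -- Glue the separations on the two pieces, cutting each away from the other piece.
    refine hKe (isInessentialOn_of_relative hA hB hAB hKc
      (U := fun i => (U₁ i ∩ Fᶜ) ∪ (U₂ i ∩ Eᶜ)) (V := fun i => (V₁ i ∩ Fᶜ) ∪ (V₂ i ∩ Eᶜ))
      (fun i => ((hU₁ i).inter hF.isOpen_compl).union ((hU₂ i).inter hE.isOpen_compl))
      (fun i => ((hV₁ i).inter hF.isOpen_compl).union ((hV₂ i).inter hE.isOpen_compl)) ?_ ?_ ?_ ?_)
    · intro i
      have h1 := Set.disjoint_left.1 (hd₁ i)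
      have h2 := Set.disjoint_left.1 (hd₂ i)
      rw [Set.disjoint_left]
      rintro x ⟨⟨hu, hf⟩ | ⟨hu, he⟩, hx⟩ ⟨⟨hv, hf'⟩ | ⟨hv, he'⟩, -⟩
      · exact h1 hu hv
      · exact (hcov hx).elim he' hf
      · exact (hcov hx).elim he hf'
      · exact h2 hu hv
    · rintro i x ⟨hxA, hx⟩
      rcases hcov hx with h | h
      · exact Or.inl ⟨hAU₁ i hxA, fun h' => hdis x hx h h'⟩
      · exact Or.inr ⟨hAU₂ i hxA, fun h' => hdis x hx h' h⟩
    · rintro i x ⟨hxB, hx⟩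
      rcases hcov hx with h | h
      · exact Or.inl ⟨hBV₁ i hxB, fun h' => hdis x hx h h'⟩
      · exact Or.inr ⟨hBV₂ i hxB, fun h' => hdis x hx h' h⟩
    · intro x hx
      rcases hcov hx with h | h
      · obtain ⟨i, hi⟩ := Set.mem_iUnion.1 (hc₁ ⟨hx, h⟩)
        have hn : x ∉ F := fun h' => hdis x hx h h'
        exact Set.mem_iUnion.2 ⟨i, hi.imp (fun g => Or.inl ⟨g, hn⟩) (fun g => Or.inl ⟨g, hn⟩)⟩
      · obtain ⟨i, hi⟩ := Set.mem_iUnion.1 (hc₂ ⟨hx, h⟩)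
        have hn : x ∉ E := fun h' => hdis x hx h' h
        exact Set.mem_iUnion.2 ⟨i, hi.imp (fun g => Or.inr ⟨g, hn⟩) (fun g => Or.inr ⟨g, hn⟩)⟩

/-- A family of pairs that is essential on a closed subset induces an essential family on it. -/
theorem isEssentialFamily_preimage_val [CompactSpace Z] [T2Space Z] {A B : ι → Set Z}
    (hA : ∀ i, IsClosed (A i)) (hB : ∀ i, IsClosed (B i)) (hAB : ∀ i, Disjoint (A i) (B i))
    {K : Set Z} (hK : IsClosed K) (hess : ¬ IsInessentialOn A B K) :
    IsEssentialFamily (fun i => ((↑) : K → Z) ⁻¹' A i) (fun i => ((↑) : K → Z) ⁻¹' B i) := by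
  refine ⟨fun i => ⟨(hA i).preimage continuous_subtype_val, (hB i).preimage continuous_subtype_val,
    (hAB i).preimage _⟩, fun L hL => ?_⟩
  choose U V hU hV hd hAU hBV hLe using hL
  choose U' hU' hUe using fun i => isOpen_induced_iff.1 (hU i)
  choose V' hV' hVe using fun i => isOpen_induced_iff.1 (hV i)
  by_contra hemp
  refine hess (isInessentialOn_of_relative hA hB hAB hK hU' hV' ?_ ?_ ?_ ?_)
  · intro i
    rw [Set.disjoint_left]
    rintro x ⟨h1, hx⟩ ⟨h2, -⟩
    refine Set.disjoint_left.1 (hd i) (?_ : (⟨x, hx⟩ : K) ∈ U i) ?_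
    · rw [← hUe]; exact h1
    · rw [← hVe]; exact h2
  · rintro i x ⟨h1, hx⟩
    have : (⟨x, hx⟩ : K) ∈ U i := hAU i h1
    rw [← hUe] at this; exact this
  · rintro i x ⟨h1, hx⟩
    have : (⟨x, hx⟩ : K) ∈ V i := hBV i h1
    rw [← hVe] at this; exact this
  · intro x hx
    by_contra hn
    refine hemp ⟨⟨x, hx⟩, Set.mem_iInter.2 fun i => ?_⟩
    rw [hLe]
    intro h
    refine hn (Set.mem_iUnion.2 ⟨i, ?_⟩)
    rw [← hUe, ← hVe] at h
    exact h

end Essential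

/-! ### Crooked partitions -/

section Crooked

variable {Z : Type u} [TopologicalSpace Z]

/-- The set `L` can be folded in three between `C` and `D`, with the folds in `V` and in `U`. -/
def IsCrookedOn (L C D U V : Set Z) : Prop :=
  ∃ X₀ X₁ X₂ : Set Z, IsClosed X₀ ∧ IsClosed X₁ ∧ IsClosed X₂ ∧ L ⊆ X₀ ∪ X₁ ∪ X₂ ∧
    C ∩ L ⊆ X₀ ∧ D ∩ L ⊆ X₂ ∧ X₀ ∩ X₁ ⊆ V ∧ X₁ ∩ X₂ ⊆ U ∧ Disjoint X₀ X₂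

/-- Any two disjoint closed sets have a partition that is crooked for a prescribed quadruple. -/
theorem exists_separation_isCrookedOn [NormalSpace Z] {A B C D U V : Set Z} (hA : IsClosed A)
    (hB : IsClosed B) (hAB : Disjoint A B) (hC : IsClosed C) (hD : IsClosed D)
    (hCD : Disjoint C D) (hU : IsOpen U) (hV : IsOpen V) (hCU : C ⊆ U) (hDV : D ⊆ V) :
    ∃ P Q : Set Z, IsOpen P ∧ IsOpen Q ∧ Disjoint P Q ∧ A ⊆ P ∧ B ⊆ Q ∧
      IsCrookedOn (P ∪ Q)ᶜ C D U V := by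
  obtain ⟨f, fA, fB, hf⟩ := exists_continuous_zero_one_of_isClosed hA hB hAB
  obtain ⟨g, gC, gU, hg⟩ := exists_continuous_zero_one_of_isClosed hC
    (hU.isClosed_compl.union hD) (Set.disjoint_union_right.2
      ⟨Set.disjoint_compl_right_iff_subset.2 hCU, hCD⟩)
  obtain ⟨h, hhD, hhV, hh⟩ := exists_continuous_zero_one_of_isClosed hD
    (hV.isClosed_compl.union hC) (Set.disjoint_union_right.2
      ⟨Set.disjoint_compl_right_iff_subset.2 hDV, hCD.symm⟩)
  -- As `f` runs through 0, 1/3, 2/3, 1, `φ` zigzags through -1, 2/3, 1/3, 2. The function `t` is 0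
  -- on `C`, 1 on `D`, below 1/2 only in `U` and above 1/2 only in `V`. The partition is `φ = t`,
  -- cut at the turning points of `φ`: there `t` is 2/3, hence in `V`, or 1/3, hence in `U`.
  let φ : Z → ℝ := fun x => max (min (5 * f x - 1) (1 - f x)) (5 * f x - 3)
  let t : Z → ℝ := fun x => (1 + g x - h x) / 2
  have hφ : Continuous φ := by fun_prop
  have ht : Continuous t := by fun_prop
  have ht0 : ∀ x, 0 ≤ t x := fun x => by have := (hg x).1; have := (hh x).2; simp only [t]; linarith
  have ht1 : ∀ x, t x ≤ 1 := fun x => by have := (hg x).2; have := (hh x).1; simp only [t]; linarith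
  have htU : ∀ x, t x < 1 / 2 → x ∈ U := fun x hx => by
    by_contra hn
    have h1 : g x = 1 := gU (Or.inl hn)
    have := (hh x).2
    simp only [t] at hx
    linarith
  have htV : ∀ x, 1 / 2 < t x → x ∈ V := fun x hx => by
    by_contra hn
    have h1 : h x = 1 := hhV (Or.inl hn)
    have := (hg x).2
    simp only [t] at hx
    linarith
  have htC : ∀ x ∈ C, t x = 0 := fun x hx => by
    have h1 : g x = 0 := gC hx
    have h2 : h x = 1 := hhV (Or.inr hx)
    simp [t, h1, h2]
  have htD : ∀ x ∈ D, t x = 1 := fun x hx => by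
    have h1 : g x = 1 := gU (Or.inr hx)
    have h2 : h x = 0 := hhD hx
    simp only [t, h1, h2]; norm_num
  have hL : ∀ x, x ∈ ({x | φ x < t x} ∪ {x | t x < φ x})ᶜ → φ x = t x := by
    intro x hx
    simp only [Set.mem_compl_iff, Set.mem_union, Set.mem_ofPred_eq, not_or, not_lt] at hx
    exact le_antisymm hx.2 hx.1
  refine ⟨{x | φ x < t x}, {x | t x < φ x}, isOpen_lt hφ ht, isOpen_lt ht hφ, ?_, ?_, ?_,
    {x | φ x = t x ∧ f x ≤ 1 / 3}, {x | φ x = t x ∧ 1 / 3 ≤ f x ∧ f x ≤ 2 / 3},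
    {x | φ x = t x ∧ 2 / 3 ≤ f x}, ?_, ?_, ?_, ?_, ?_, ?_, ?_, ?_, ?_⟩
  · rw [Set.disjoint_left]
    exact fun x h1 h2 => lt_asymm (show φ x < t x from h1) h2
  · intro x hx
    have h1 : f x = 0 := fA hx
    have : φ x = -1 := by simp only [φ, h1]; norm_num
    have := ht0 x
    change φ x < t x
    linarith
  · intro x hx
    have h1 : f x = 1 := fB hx
    have : φ x = 2 := by simp only [φ, h1]; norm_num
    have := ht1 x
    change t x < φ x
    linarith
  · exact (isClosed_eq hφ ht).inter (isClosed_le f.continuous continuous_const)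
  · exact (isClosed_eq hφ ht).inter ((isClosed_le continuous_const f.continuous).inter
      (isClosed_le f.continuous continuous_const))
  · exact (isClosed_eq hφ ht).inter (isClosed_le continuous_const f.continuous)
  · intro x hx
    have := hL x hx
    rcases le_total (f x) (1 / 3) with h1 | h1
    · exact Or.inl (Or.inl ⟨this, h1⟩)
    · rcases le_total (f x) (2 / 3) with h2 | h2
      · exact Or.inl (Or.inr ⟨this, h1, h2⟩)
      · exact Or.inr ⟨this, h2⟩
  · rintro x ⟨hxC, hx⟩
    have h1 := hL x hx
    refine ⟨h1, ?_⟩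
    rw [htC x hxC] at h1
    by_contra! hc
    have h2 : 1 - f x ≤ 0 ∨ 5 * f x - 1 ≤ 0 := by
      have := (le_max_left _ _).trans h1.le
      rwa [min_le_iff, or_comm] at this
    have h3 : 5 * f x - 3 ≤ 0 := (le_max_right _ _).trans h1.le
    rcases h2 with h2 | h2 <;> linarith
  · rintro x ⟨hxD, hx⟩
    have h1 := hL x hx
    refine ⟨h1, ?_⟩
    rw [htD x hxD] at h1
    by_contra! hc
    have h2 : 1 ≤ min (5 * f x - 1) (1 - f x) ∨ 1 ≤ 5 * f x - 3 := le_max_iff.1 h1.ge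
    rcases h2 with h2 | h2
    · have := le_min_iff.1 h2; linarith
    · linarith
  · rintro x ⟨⟨h1, h2⟩, -, h3, -⟩
    apply htV
    have h4 : f x = 1 / 3 := le_antisymm h2 h3
    rw [← h1]
    simp only [φ, h4]
    norm_num
  · rintro x ⟨⟨h1, -, h2⟩, -, h3⟩
    apply htU
    have h4 : f x = 2 / 3 := le_antisymm h2 h3
    rw [← h1]
    simp only [φ, h4]
    norm_num
  · rw [Set.disjoint_left]
    rintro x ⟨-, h2⟩ ⟨-, h3⟩
    have h2 : f x ≤ 1 / 3 := h2
    have h3 : 2 / 3 ≤ f x := h3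
    linarith

/-- A connected set that meets one of two closed sets, disjoint on it and covering it, lies in
that closed set. -/
lemma IsPreconnected.subset_of_isClosed {K E F : Set Z} (hK : IsPreconnected K)
    (hE : IsClosed E) (hF : IsClosed F) (hcov : K ⊆ E ∪ F) (hd : ∀ x ∈ K, x ∈ E → x ∈ F → False)
    {a : Z} (ha : a ∈ K) (haE : a ∈ E) : K ⊆ E := by
  intro x hx
  by_contra hn
  obtain ⟨y, h1, h2, h3⟩ := isPreconnected_closed_iff.1 hK E F hE hF hcov ⟨a, ha, haE⟩
    ⟨x, hx, (hcov hx).resolve_left hn⟩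
  exact hd y h1 h2 h3

/-- A set that is crooked for sufficiently many quadruples contains no decomposable continuum. -/
theorem disjoint_of_isCrookedOn {L A B C D U V : Set Z} (h : IsCrookedOn L C D U V)
    (hA : IsPreconnected A) (hB : IsPreconnected B) (hAL : A ⊆ L) (hBL : B ⊆ L)
    (hAC : (A ∩ C).Nonempty) (hBD : (B ∩ D).Nonempty) (hAV : Disjoint A V) (hBU : Disjoint B U) :
    Disjoint A B := by
  obtain ⟨X₀, X₁, X₂, h0, h1, h2, hcov, hC, hD, h01, h12, h02⟩ := h
  obtain ⟨a, haA, haC⟩ := hAC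
  obtain ⟨b, hbB, hbD⟩ := hBD
  -- `A` starts in `X₀` and can leave only through `X₀ ∩ X₁ ⊆ V`, which it avoids; symmetrically `B`
  -- is trapped in `X₂`.
  have hA0 : A ⊆ X₀ := by
    refine IsPreconnected.subset_of_isClosed hA h0 (h1.union h2)
      (fun x hx => by simpa [or_assoc] using hcov (hAL hx)) ?_ haA (hC ⟨haC, hAL haA⟩)
    rintro x hx hx0 (hx1 | hx2)
    exacts [Set.disjoint_left.1 hAV hx (h01 ⟨hx0, hx1⟩), Set.disjoint_left.1 h02 hx0 hx2]
  have hB2 : B ⊆ X₂ := by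
    refine IsPreconnected.subset_of_isClosed hB h2 (h0.union h1)
      (fun x hx => (hcov (hBL hx)).symm) ?_ hbB (hD ⟨hbD, hBL hbB⟩)
    rintro x hx hx2 (hx0 | hx1)
    exacts [Set.disjoint_left.1 h02 hx0 hx2, Set.disjoint_left.1 hBU hx (h12 ⟨hx1, hx2⟩)]
  exact h02.mono hA0 hB2

end Crooked

/-! ### Weight bounds -/

section Weight

open Cardinal TopologicalSpace

/-- The Tychonoff cube `I ^ J` has a base of cardinality at most `#J`, for infinite `J`. -/
theorem exists_basis_cube_mk_le (J : Type u) [Infinite J] :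
    ∃ B : Set (Set (J → unitInterval)), IsTopologicalBasis B ∧ #B ≤ #J := by
  classical
  let T := countableBasis unitInterval
  refine ⟨_, isTopologicalBasis_pi fun _ : J => isBasis_countableBasis unitInterval, ?_⟩
  let G : Finset (J × T) → Set (J → unitInterval) := fun s => {x | ∀ p ∈ s, x p.1 ∈ p.2.1}
  refine (mk_le_mk_of_subset (t := Set.range G) ?_).trans (mk_range_le.trans ?_)
  · rintro S ⟨U, F, hU, rfl⟩
    refine ⟨F.attach.image fun i => (i.1, ⟨U i.1, hU i.1 i.2⟩), ?_⟩
    ext x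
    simp only [G, Set.mem_ofPred_eq, Finset.mem_image, Finset.mem_attach, true_and, Subtype.exists,
      Set.mem_pi, SetLike.mem_coe]
    refine ⟨fun h i hi => h (i, ⟨U i, hU i hi⟩) ⟨i, hi, rfl⟩, ?_⟩
    rintro h _ ⟨i, hi, rfl⟩
    exact h i hi
  · have hT : #T ≤ ℵ₀ := (countable_countableBasis unitInterval).le_aleph0
    have hJ : ℵ₀ ≤ #J := aleph0_le_mk J
    have hJT : #(J × T) ≤ #J := by
      rw [mk_prod, lift_id']
      refine (mul_le_mul' le_rfl (lift_le_aleph0.2 hT)).trans ?_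
      simp [mul_aleph0_eq hJ]
    obtain ⟨s, hs, -, -⟩ := (isBasis_countableBasis unitInterval).exists_subset_of_mem_open
      (Set.mem_univ 0) isOpen_univ
    have : Nonempty T := ⟨⟨s, hs⟩⟩
    have : Infinite (J × T) := inferInstance
    rwa [mk_finset_of_infinite]

/-- A compact space that maps onto the Tychonoff cube `I ^ J` has no base of size less than `#J`,
for infinite `J`. -/
theorem mk_le_mk_basis_of_surjective {X : Type u} [TopologicalSpace X] [CompactSpace X]
    {J : Type u} [Infinite J] {f : X → J → unitInterval} (hf : Continuous f)
    (hs : Function.Surjective f) {B : Set (Set X)} (hB : IsTopologicalBasis B) : #J ≤ #B := by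
  classical
  have hfi : ∀ i, Continuous fun x => f x i := fun i => (continuous_apply i).comp hf
  -- The finite set `t i` separates the fibres over 0 and 1 in coordinate `i`. It determines `i`,
  -- because some point has coordinate `i` equal to 0 and all others equal to 1.
  have key : ∀ i, ∃ t : Finset B, (∀ x, f x i = 0 → ∃ s ∈ t, x ∈ s.1) ∧
      ∀ s ∈ t, ∀ x ∈ s.1, f x i ≠ 1 := by
    intro i
    have hO : IsOpen {x | f x i ≠ 1} := isOpen_ne_fun (hfi i) continuous_const
    have hZ : IsClosed {x | f x i = 0} := isClosed_eq (hfi i) continuous_const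
    obtain ⟨t, ht⟩ := hZ.isCompact.elim_finite_subcover
      (fun s : {s : B // s.1 ⊆ {x | f x i ≠ 1}} => s.1.1) (fun s => hB.isOpen s.1.2) (by
        intro x hx
        have hx : f x i = 0 := hx
        obtain ⟨s, hsB, hxs, hsO⟩ := hB.exists_subset_of_mem_open
          (show x ∈ {x | f x i ≠ 1} by change f x i ≠ 1; rw [hx]; exact zero_ne_one) hO
        exact Set.mem_iUnion.2 ⟨⟨⟨s, hsB⟩, hsO⟩, hxs⟩)
    refine ⟨t.image Subtype.val, fun x hx => ?_, fun s hs x hx => ?_⟩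
    · obtain ⟨s, hst, hxs⟩ := Set.mem_iUnion₂.1 (ht hx)
      exact ⟨s.1, Finset.mem_image_of_mem _ hst, hxs⟩
    · obtain ⟨s', -, rfl⟩ := Finset.mem_image.1 hs
      exact s'.2 hx
  choose t ht0 ht1 using key
  have hinj : Function.Injective t := by
    intro i j hij
    by_contra hne
    obtain ⟨x, hx⟩ := hs (fun k => if k = i then 0 else 1)
    obtain ⟨s, hst, hxs⟩ := ht0 i x (by simp [hx])
    exact ht1 j s (hij ▸ hst) x hxs (by simp [hx, Ne.symm hne])
  have : Infinite (Finset B) := Infinite.of_injective t hinj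
  have : Infinite B := by
    by_contra h
    have := not_infinite_iff_finite.1 h
    exact not_finite (Finset B)
  rw [← mk_finset_of_infinite B]
  exact mk_le_of_injective hinj

end Weight

/-! ### Assembling the continuum -/

/-- An essential map from a compact space to a Tychonoff cube is surjective. -/
theorem IsEssentialMap.surjective {X : Type u} [TopologicalSpace X] [CompactSpace X] {ι : Type v}
    {f : X → ι → unitInterval} (hf : IsEssentialMap f) : Function.Surjective f := by
  obtain ⟨hc, -, hess⟩ := hf
  have hd : Dense (Set.univ.pi fun _ : ι => ({0, 1}ᶜ : Set unitInterval)) :=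
    dense_pi _ fun i _ => by
      rw [Set.compl_eq_univ_sdiff]
      exact dense_univ.sdiff_finite (by simp)
  have hsub : (Set.univ.pi fun _ : ι => ({0, 1}ᶜ : Set unitInterval)) ⊆ Set.range f := by
    intro p hp
    have hp0 : ∀ i, 0 < p i := fun i => unitInterval.pos_iff_ne_zero.2
      fun h => hp i trivial (by simp [h])
    have hp1 : ∀ i, p i < 1 := fun i => unitInterval.lt_one_iff_ne_one.2
      fun h => hp i trivial (by simp [h])
    have hfi : ∀ i, Continuous fun x => f x i := fun i => (continuous_apply i).comp hc
    -- For `p` off all faces the coordinate fibres over `p i` are partitions, and a common point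
    -- maps to `p`. Such `p` are dense and the range is closed.
    obtain ⟨x, hx⟩ := hess (fun i => {x | f x i = p i}) (fun i =>
      ⟨{x | f x i < p i}, {x | p i < f x i}, isOpen_lt (hfi i) continuous_const,
        isOpen_lt continuous_const (hfi i),
        Set.disjoint_left.2 fun x h1 h2 => lt_asymm (show f x i < p i from h1) h2,
        fun x hx => by
          have hx : f x i = 0 := hx
          change f x i < p i
          rw [hx]; exact hp0 i,
        fun x hx => by
          have hx : f x i = 1 := hx
          change p i < f x i
          rw [hx]; exact hp1 i,
        by
          ext x
          change f x i = p i ↔ ¬ (f x i < p i ∨ p i < f x i)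
          rw [← ne_iff_lt_or_gt, not_not]⟩)
    exact ⟨x, funext fun i => Set.mem_iInter.1 hx i⟩
  rw [← Set.range_eq_univ, ← (isCompact_range hc).isClosed.closure_eq]
  exact (hd.mono hsub).closure_eq

/-- A closed subset of a compact Hausdorff space with base `B` is hereditarily indecomposable if it
is crooked for all quadruples from `B`. -/
theorem hereditarilyIndecomposable_of_isCrookedOn {Z : Type u} [TopologicalSpace Z]
    [CompactSpace Z] [T2Space Z] {B : Set (Set Z)} (hB : TopologicalSpace.IsTopologicalBasis B)
    {K : Set Z} (hK : IsClosed K)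
    (hcr : ∀ b₁ ∈ B, ∀ b₂ ∈ B, ∀ b₃ ∈ B, ∀ b₄ ∈ B, closure b₁ ⊆ b₂ → closure b₃ ⊆ b₄ →
      Disjoint (closure b₁) (closure b₃) →
      ∃ L, K ⊆ L ∧ IsCrookedOn L (closure b₁) (closure b₃) b₂ b₄) :
    HereditarilyIndecomposable K := by
  rintro M ⟨hMc, hM⟩ ⟨E, F, ⟨hEc, hE⟩, ⟨hFc, hF⟩, hEM, hFM, hEF⟩
  obtain ⟨a, haM, haF⟩ := Set.exists_of_ssubset hFM
  obtain ⟨b, hbM, hbE⟩ := Set.exists_of_ssubset hEM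
  have haE : a ∈ E := (hEF.ge haM).resolve_right haF
  have hbF : b ∈ F := (hEF.ge hbM).resolve_left hbE
  have hab : a.1 ≠ b.1 := fun h => haF (Subtype.ext h ▸ hbF)
  have hE' : IsClosed (Subtype.val '' E) := hK.isClosedEmbedding_subtypeVal.isClosedMap _ hEc
  have hF' : IsClosed (Subtype.val '' F) := hK.isClosedEmbedding_subtypeVal.isClosedMap _ hFc
  have haF' : a.1 ∉ Subtype.val '' F := fun ⟨c, hc, h⟩ => haF (Subtype.ext h ▸ hc)
  have hbE' : b.1 ∉ Subtype.val '' E := fun ⟨c, hc, h⟩ => hbE (Subtype.ext h ▸ hc)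
  obtain ⟨P, Q, hP, hQ, haP, hbQ, hPQ⟩ := t2_separation hab
  have pick : ∀ (x : Z) (O : Set Z), IsOpen O → x ∈ O →
      ∃ c ∈ B, ∃ d ∈ B, x ∈ c ∧ closure c ⊆ d ∧ d ⊆ O := by
    intro x O hO hx
    obtain ⟨d, hd, hxd, hdO⟩ := hB.exists_subset_of_mem_open hx hO
    obtain ⟨c, hc, hxc, hcd⟩ := hB.exists_closure_subset ((hB.isOpen hd).mem_nhds hxd)
    exact ⟨c, hc, d, hd, hxc, hcd, hdO⟩
  -- Here `b₂` misses `F` and `b₄` will miss `E`, so crookedness makes `E` and `F` disjoint, against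
  -- connectedness of `M`.
  obtain ⟨b₁, h₁, b₂, h₂, ha₁, h12, h2⟩ := pick a.1 (P ∩ (Subtype.val '' F)ᶜ)
    (hP.inter hF'.isOpen_compl) ⟨haP, haF'⟩
  obtain ⟨b₃, h₃, b₄, h₄, hb₃, h34, h4⟩ := pick b.1 (Q ∩ (Subtype.val '' E)ᶜ)
    (hQ.inter hE'.isOpen_compl) ⟨hbQ, hbE'⟩
  obtain ⟨L, hKL, hL⟩ := hcr b₁ h₁ b₂ h₂ b₃ h₃ b₄ h₄ h12 h34
    (hPQ.mono (fun x hx => (h2 (h12 hx)).1) (fun x hx => (h4 (h34 hx)).1))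
  have hsub : ∀ S : Set K, Subtype.val '' S ⊆ L := fun S => by
    rintro _ ⟨x, -, rfl⟩; exact hKL x.2
  have hdis := disjoint_of_isCrookedOn hL
    (hE.isPreconnected.image _ continuous_subtype_val.continuousOn)
    (hF.isPreconnected.image _ continuous_subtype_val.continuousOn) (hsub E) (hsub F)
    ⟨a.1, ⟨a, haE, rfl⟩, subset_closure ha₁⟩ ⟨b.1, ⟨b, hbF, rfl⟩, subset_closure hb₃⟩
    (Set.disjoint_left.2 fun x hx hx' => (h4 hx').2 hx)
    (Set.disjoint_left.2 fun x hx hx' => (h2 hx').2 hx)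
  obtain ⟨x, -, hxE, hxF⟩ := isPreconnected_closed_iff.1 hM.isPreconnected E F hEc hFc hEF.ge
    ⟨a, haM, haE⟩ ⟨b, hbM, hbF⟩
  exact Set.disjoint_left.1 hdis ⟨x, hxE, rfl⟩ ⟨x, hxF, rfl⟩

lemma isClosed_faceZero {ι : Type v} (i : ι) : IsClosed (faceZero i) :=
  isClosed_eq (continuous_apply i) continuous_const

lemma isClosed_faceOne {ι : Type v} (i : ι) : IsClosed (faceOne i) :=
  isClosed_eq (continuous_apply i) continuous_const

lemma disjoint_faceZero_faceOne {ι : Type v} (i : ι) :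
    Disjoint (faceZero i) (faceOne i) :=
  Set.disjoint_left.2 fun _ h0 h1 => zero_ne_one (Eq.trans (Eq.symm h0) h1)

/-- The cube `I ^ (ι ⊕ ι)` contains a hereditarily indecomposable continuum on which the pairs of
opposite faces that belong to the first summand are essential. -/
theorem exists_hereditarilyIndecomposable_subset_cube (ι : Type u) [Infinite ι] :
    ∃ K : Set (ι ⊕ ι → unitInterval), IsClosed K ∧ IsConnected K ∧ HereditarilyIndecomposable K ∧
      ¬ IsInessentialOn (fun i : ι => faceZero (Sum.inl i : ι ⊕ ι))
        (fun i => faceOne (Sum.inl i)) K := by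
  obtain ⟨B, hB, hBc⟩ := exists_basis_cube_mk_le (ι ⊕ ι)
  have hι : Cardinal.aleph0 ≤ Cardinal.mk ι := Cardinal.aleph0_le_mk ι
  have hcard : Cardinal.mk (B × B × B × B) ≤ Cardinal.mk ι := by
    have h1 : Cardinal.mk B ≤ Cardinal.mk ι := by
      simpa [Cardinal.add_eq_self hι] using hBc
    have hsq : ∀ α β : Type u, Cardinal.mk α ≤ Cardinal.mk ι → Cardinal.mk β ≤ Cardinal.mk ι →
        Cardinal.mk (α × β) ≤ Cardinal.mk ι := by
      intro α β hα hβ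
      simpa [Cardinal.mul_eq_self hι] using mul_le_mul' hα hβ
    exact hsq _ _ h1 (hsq _ _ h1 (hsq _ _ h1 h1))
  obtain ⟨b₀, hb₀, -, -⟩ := hB.exists_subset_of_mem_open (Set.mem_univ 0) isOpen_univ
  have : Nonempty (B × B × B × B) := ⟨⟨b₀, hb₀⟩, ⟨b₀, hb₀⟩, ⟨b₀, hb₀⟩, ⟨b₀, hb₀⟩⟩
  obtain ⟨e⟩ := Cardinal.le_def _ _ |>.1 hcard
  let q : ι → B × B × B × B := Function.invFun e
  have hq : Function.Surjective q := Function.invFun_surjective e.injective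
  have hpart : ∀ j : ι, ∃ P Q : Set (ι ⊕ ι → unitInterval), IsOpen P ∧ IsOpen Q ∧ Disjoint P Q ∧
      faceZero (Sum.inr j) ⊆ P ∧ faceOne (Sum.inr j) ⊆ Q ∧
      -- Inadmissible quadruples receive an arbitrary separation.
      (closure (q j).1.1 ⊆ (q j).2.1.1 → closure (q j).2.2.1.1 ⊆ (q j).2.2.2.1 →
        Disjoint (closure (q j).1.1) (closure (q j).2.2.1.1) →
        IsCrookedOn (P ∪ Q)ᶜ (closure (q j).1.1) (closure (q j).2.2.1.1)
          (q j).2.1.1 (q j).2.2.2.1) := by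
    intro j
    by_cases h : closure (q j).1.1 ⊆ (q j).2.1.1 ∧ closure (q j).2.2.1.1 ⊆ (q j).2.2.2.1 ∧
        Disjoint (closure (q j).1.1) (closure (q j).2.2.1.1)
    · obtain ⟨P, Q, hP, hQ, hPQ, h0, h1, hc⟩ := exists_separation_isCrookedOn
        (isClosed_faceZero (Sum.inr j)) (isClosed_faceOne (Sum.inr j))
        (disjoint_faceZero_faceOne _) isClosed_closure isClosed_closure h.2.2
        (hB.isOpen (q j).2.1.2) (hB.isOpen (q j).2.2.2.2) h.1 h.2.1
      exact ⟨P, Q, hP, hQ, hPQ, h0, h1, fun _ _ _ => hc⟩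
    · obtain ⟨P, Q, hP, hQ, h0, h1, hPQ⟩ := normal_separation
        (isClosed_faceZero (Sum.inr j : ι ⊕ ι)) (isClosed_faceOne (Sum.inr j))
        (disjoint_faceZero_faceOne _)
      exact ⟨P, Q, hP, hQ, hPQ, h0, h1, fun a b c => absurd ⟨a, b, c⟩ h⟩
  choose P Q hP hQ hPQ h0 h1 hcr using hpart
  have hess : ¬ IsInessentialOn (fun i : ι => faceZero (Sum.inl i : ι ⊕ ι))
      (fun i => faceOne (Sum.inl i)) (⋂ j, (P j ∪ Q j)ᶜ) := by
    rintro ⟨U, V, hU, hV, hd, hU0, hV1, hcov⟩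
    obtain ⟨x, hx⟩ := exists_notMem_of_separates_faces (Sum.elim U P) (Sum.elim V Q)
      (by rintro (i | i); exacts [hU i, hP i]) (by rintro (i | i); exacts [hV i, hQ i])
      (by rintro (i | i); exacts [hd i, hPQ i]) (by rintro (i | i); exacts [hU0 i, h0 i])
      (by rintro (i | i); exacts [hV1 i, h1 i])
    obtain ⟨i, hi⟩ := Set.mem_iUnion.1 (hcov (Set.mem_iInter.2 fun j hj =>
      hj.elim (hx (Sum.inr j)).1 (hx (Sum.inr j)).2))
    exact hi.elim (hx (Sum.inl i)).1 (hx (Sum.inl i)).2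
  obtain ⟨K, hKY, hK, hKc, hKe⟩ := exists_isConnected_not_isInessentialOn
    (fun _ => isClosed_faceZero _) (fun _ => isClosed_faceOne _)
    (fun _ => disjoint_faceZero_faceOne _)
    (isClosed_iInter fun j => ((hP j).union (hQ j)).isClosed_compl) hess
  refine ⟨K, hK, hKc, hereditarilyIndecomposable_of_isCrookedOn hB hK ?_, hKe⟩
  intro b₁ h₁ b₂ h₂ b₃ h₃ b₄ h₄ h12 h34 h13
  obtain ⟨j, hj⟩ := hq (⟨b₁, h₁⟩, ⟨b₂, h₂⟩, ⟨b₃, h₃⟩, ⟨b₄, h₄⟩)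
  have := hcr j
  rw [hj] at this
  exact ⟨_, hKY.trans (Set.iInter_subset _ j), this h12 h34 h13⟩

end HIContinua

theorem mainTheorem2 (κ : Cardinal.{u}) (hκ : Cardinal.aleph0 ≤ κ) :
    ∃ (X : Type u) (_ : TopologicalSpace X),
      HIContinua.IsContinuum X ∧ HIContinua.HereditarilyIndecomposable X ∧
      HIContinua.weight X = κ ∧
      ∃ f : X → (κ.out → unitInterval),
        HIContinua.IsEssentialMap f ∧ Function.Surjective f := by
  have : Infinite κ.out := by rwa [Cardinal.infinite_iff, Cardinal.mk_out]
  obtain ⟨K, hK, hKc, hKi, hKe⟩ :=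
    HIContinua.exists_hereditarilyIndecomposable_subset_cube κ.out
  have hcomp : CompactSpace K := isCompact_iff_compactSpace.1 hK.isCompact
  let f : K → κ.out → unitInterval := fun x i => x.1 (Sum.inl i)
  have hf : HIContinua.IsEssentialMap f :=
    ⟨continuous_pi fun i => (continuous_apply (Sum.inl i)).comp continuous_subtype_val,
      HIContinua.isEssentialFamily_preimage_val (fun _ => HIContinua.isClosed_faceZero _)
      (fun _ => HIContinua.isClosed_faceOne _) (fun _ => HIContinua.disjoint_faceZero_faceOne _) hK hKe⟩
  refine ⟨K, inferInstance, ⟨hcomp, inferInstance, isConnected_iff_connectedSpace.1 hKc⟩, hKi, ?_,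
    f, hf, hf.surjective⟩
  obtain ⟨B, hB, hBc⟩ := HIContinua.exists_basis_cube_mk_le (κ.out ⊕ κ.out)
  have hBK := hB.isInducing (Topology.IsInducing.subtypeVal (t := K))
  apply le_antisymm
  · have hw : HIContinua.weight K ≤ _ := csInf_le' ⟨_, hBK, rfl⟩
    refine hw.trans (Cardinal.mk_image_le.trans (hBc.trans ?_))
    simp [Cardinal.add_eq_self hκ]
  · refine le_csInf ⟨_, _, hBK, rfl⟩ ?_
    rintro c ⟨B', hB', rfl⟩
    simpa using HIContinua.mk_le_mk_basis_of_surjective hf.1 hf.surjective hB'
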